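/- Let $E,J,R\in\mathbb C^{n\times n}$ and $B\in\mathbb C^{n\times m}$ with $E=E^H\ge 0$, $R=R^H\ge 0$, $J=-J^H$ and $\operatorname{rank} B=m$ (the coefficients of the port-Hamiltonian descriptor system $E\dot x=(J-R)x+Bu$, $y=B^Hx$). For a matrix $M$ let $\mathcal S_\infty(M)$ denote any matrix of full column rank whose columns span the right nullspace $\{x: Mx=0\}$, and $\mathcal T_\infty(M)$ any matrix of full column rank whose columns span the left nullspace $\{x: x^HM=0\}$. A pair $(\mathcal E,\mathcal A)$ of $n\times n$ matrices is regular if $\det(\lambda_0\mathcal E-\mathcal A)\neq0$ for some $\lambda_0\in\mathbb C$; the index of a regular pair is the size of the largest nilpotent block $\lambda N_\sigma-I_\sigma$ in the Kronecker canonical form of $\lambda\mathcal E-\mathcal A$, where $N_\sigma$ is the $\sigma\times\sigma$ nilpotent Jordan block (and it is $0$ if there is no such block). Call matrices $K,F_S,F_H\in\mathbb C^{m\times m}$ admissible if $F_S=-F_S^H$, $F_H=F_H^H$, $E+BKB^H\ge0$, $R+BF_HB^H\ge 0$, and the pair $$\bigl(E+BKB^H,\; J+BF_SB^H-(R+BF_HB^H)\bigr)$$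 is regular and of index at most one. **Theorem.** Admissible $K,F_S,F_H$ exist if and only if $$\operatorname{rank}\,[\,E,\;J-R,\;B\,]=n \qquad (1)$$ and $$\operatorname{rank}\Bigl(\mathcal T_\infty^H(B)\,E\,\mathcal S_\infty\bigl(\mathcal T_\infty^H([E,B])(J-R)\bigr)\Bigr)=\operatorname{rank}[E,B]-\operatorname{rank}B. \qquad (2)$$ Moreover, if (1) and (2) hold, then for every integer $r$ there exist admissible $K,F_S,F_H$ with $\operatorname{rank}(E+BKB^H)=r$ if and only if $$\operatorname{rank}[E,B]-\operatorname{rank}B\;\le\; r\;\le\;\operatorname{rank}\left(\mathcal T_\infty^H\!\left((J-R)\,\mathcal S_\infty\!\left(\begin{bmatrix}E\\B^H\end{bmatrix}\right)\right)[E,B]\right).$$ -/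

import Mathlib

open Matrix
open scoped ComplexOrder

noncomputable section

/-- The pencil `λ E - A` (with `E`, `A` square) is regular: `det (λ₀ E - A) ≠ 0` for some
complex `λ₀`. -/
def PencilRegular {n : ℕ} (E A : Matrix (Fin n) (Fin n) ℂ) : Prop :=
  ∃ s : ℂ, (s • E - A).det ≠ 0

/-- The `σ × σ` nilpotent Jordan block, with ones on the first superdiagonal. -/
def nilBlock (σ : ℕ) : Matrix (Fin σ) (Fin σ) ℂ :=
  Matrix.of fun i j => if (i : ℕ) + 1 = (j : ℕ) then 1 else 0

/-- `PencilHasIndex E A ν`: the regular pencil `λ E - A` has index `ν`.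
There are nonsingular `S`, `T` such that, after identifying the index sets by `e`,
`S (λ E - A) T = diag (λ I - Λ, λ N - I)`, where `N` is the block diagonal matrix of nilpotent
Jordan blocks of sizes `σ 0, …, σ (k - 1)`, and `ν` is the size of the largest of these blocks
(`ν = 0` when there is none, which is the case of an invertible `E`). A further similarity would
bring the finite part `Λ` to Jordan form; this does not affect the index. -/
def PencilHasIndex {n : ℕ} (E A : Matrix (Fin n) (Fin n) ℂ) (ν : ℕ) : Prop :=
  ∃ (p k : ℕ) (σ : Fin k → ℕ) (e : Fin n ≃ Fin p ⊕ (Σ j : Fin k, Fin (σ j)))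
    (Λ : Matrix (Fin p) (Fin p) ℂ) (S T : Matrix (Fin n) (Fin n) ℂ),
    (∀ j, 0 < σ j) ∧ IsUnit S.det ∧ IsUnit T.det ∧
    Matrix.reindex e e (S * E * T) =
      Matrix.fromBlocks 1 0 0 (Matrix.blockDiagonal' fun j => nilBlock (σ j)) ∧
    Matrix.reindex e e (S * A * T) = Matrix.fromBlocks Λ 0 0 1 ∧
    ν = Finset.univ.sup σ

/-- The pencil `λ E - A` has index at most one. -/
def PencilIndexLeOne {n : ℕ} (E A : Matrix (Fin n) (Fin n) ℂ) : Prop :=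
  ∃ ν : ℕ, PencilHasIndex E A ν ∧ ν ≤ 1

/-- `S` is a matrix `𝒮_∞(M)`: it has full column rank and its columns span the right nullspace
`{x | M x = 0}` of `M`. -/
def IsRightNullMatrix {ι κ : Type*} [Fintype κ] {k : ℕ}
    (M : Matrix ι κ ℂ) (S : Matrix κ (Fin k) ℂ) : Prop :=
  LinearIndependent ℂ S.col ∧
    Submodule.span ℂ (Set.range S.col) = LinearMap.ker M.mulVecLin

/-- `T` is a matrix `𝒯_∞(M)`: it has full column rank and its columns span the left nullspace
`{x | xᴴ M = 0} = {x | Mᴴ x = 0}` of `M`. -/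
def IsLeftNullMatrix {ι κ : Type*} [Fintype ι] {k : ℕ}
    (M : Matrix ι κ ℂ) (T : Matrix ι (Fin k) ℂ) : Prop :=
  IsRightNullMatrix Mᴴ T

theorem exists_isRightNullMatrix {ι κ : Type*} [Fintype κ] (M : Matrix ι κ ℂ) :
    ∃ (k : ℕ) (S : Matrix κ (Fin k) ℂ), IsRightNullMatrix M S := by
  let b := Module.finBasis ℂ (LinearMap.ker M.mulVecLin)
  refine ⟨_, Matrix.of fun i j => (b j : κ → ℂ) i, ?_, ?_⟩
  · exact b.linearIndependent.map' (LinearMap.ker M.mulVecLin).subtype (Submodule.ker_subtype _)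
  · have h := congrArg (Submodule.map (LinearMap.ker M.mulVecLin).subtype) b.span_eq
    rw [Submodule.map_span, Submodule.map_subtype_top, ← Set.range_comp] at h
    exact h

theorem exists_isLeftNullMatrix {ι κ : Type*} [Fintype ι] (M : Matrix ι κ ℂ) :
    ∃ (k : ℕ) (T : Matrix ι (Fin k) ℂ), IsLeftNullMatrix M T :=
  exists_isRightNullMatrix Mᴴ

/-- The feedbacks `K`, `F_S`, `F_H` solve the regularization and index reduction problem for the
port-Hamiltonian system `E x' = (J - R) x + B u`, `y = Bᴴ x`. -/
structure IsRegularizingFeedback {n m : ℕ} (E J R : Matrix (Fin n) (Fin n) ℂ)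
    (B : Matrix (Fin n) (Fin m) ℂ) (K F_S F_H : Matrix (Fin m) (Fin m) ℂ) : Prop where
  skew : F_S = -F_Sᴴ
  hermitian : F_H = F_Hᴴ
  posSemidef_E : (E + B * K * Bᴴ).PosSemidef
  posSemidef_R : (R + B * F_H * Bᴴ).PosSemidef
  regular : PencilRegular (E + B * K * Bᴴ) (J + B * F_S * Bᴴ - (R + B * F_H * Bᴴ))
  index_le_one : PencilIndexLeOne (E + B * K * Bᴴ) (J + B * F_S * Bᴴ - (R + B * F_H * Bᴴ))

end

/-! ### Orthogonality, dimension counts and null matrices in coordinate-free form. -/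

section LinearAlgebra

open Module

variable {ι κ μ : Type*} [Fintype κ]

/-! Write `A = J - R`, `V = range [E, B]`, `H = E⁻¹(range B)` and `Y = A (ker E ∩ ker Bᴴ)`. Being
regular of index at most one means that a nonzero vector of the kernel of the first matrix is never
sent by the second into the range of the first (`KernelNondegenerate`). Conditions (1) and (2)
together say `A H + V = ℂⁿ` (`rank_conditions_iff`), and the upper bound on `r` is `rank [E, B] -
dim (V ∩ Y)`.

Necessity: let `E'`, `A'` be the closed-loop matrices. Then `A' (ker E') + range E'` is the whole
space, which gives `A H + V = ℂⁿ` because `E'`, `A'` differ from `E`, `A` only by vectors of `range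
B`. The lower bound on the rank comes from `V = range E' + range B`, the upper one from `range E' ∩
V ∩ Y = 0`.

Sufficiency: positivity of `E` yields a right inverse `G` of `Bᴴ` with `E G = B (Gᴴ E G)`. Then `K =
Mᴴ M - Gᴴ E G` makes `E'` the sum of a positive semidefinite matrix vanishing on `range G` and `(M
Bᴴ)ᴴ (M Bᴴ)`, so `N = ker M` controls the rank. With `F_S = 0`, `F_H = 1`, dissipation forces a bad
kernel vector into `ker E ∩ ker R ∩ ker Bᴴ`. If `N` contains `Gᴴ (V ∩ Y)`, that vector vanishes.
Varying `dim N` realizes every rank allowed (`exists_isRegularizingFeedback`). -/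

theorem star_dotProduct_mulVec_eq [Fintype ι] (M : Matrix ι κ ℂ) (x : ι → ℂ) (y : κ → ℂ) :
    star x ⬝ᵥ (M *ᵥ y) = star (Mᴴ *ᵥ x) ⬝ᵥ y := by
  rw [star_mulVec, conjTranspose_conjTranspose, dotProduct_mulVec]

theorem star_dotProduct_eq_zero_comm [Fintype ι] {x y : ι → ℂ} (h : star x ⬝ᵥ y = 0) : star y ⬝ᵥ x = 0 := by
  rw [← star_star y, star_dotProduct_star] at h
  exact star_eq_zero.1 h

/-- A vector orthogonal to everything that is orthogonal to a subspace lies in the subspace. -/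
theorem mem_of_forall_orthogonal [Fintype ι] {U : Submodule ℂ (ι → ℂ)} {v : ι → ℂ}
    (h : ∀ y : ι → ℂ, (∀ u ∈ U, star y ⬝ᵥ u = 0) → star y ⬝ᵥ v = 0) : v ∈ U := by
  classical
  by_contra hv
  obtain ⟨g, hgv, hgU⟩ := U.exists_le_ker_of_notMem hv
  have hg : ∀ x, g x = star (fun i => star (g (Pi.single i 1))) ⬝ᵥ x := by
    intro x
    conv_lhs => rw [pi_eq_sum_univ' x, map_sum]
    simp [dotProduct, mul_comm]
  exact hgv (by rw [hg]; exact h _ fun u hu => by rw [← hg]; exact hgU hu)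

theorem eq_top_of_forall_orthogonal [Fintype ι] {U : Submodule ℂ (ι → ℂ)}
    (h : ∀ y : ι → ℂ, (∀ u ∈ U, star y ⬝ᵥ u = 0) → y = 0) : U = ⊤ := by
  refine eq_top_iff.2 fun v _ => mem_of_forall_orthogonal fun y hy => ?_
  rw [h y hy, star_zero, zero_dotProduct]

theorem mem_range_mulVecLin_iff [Fintype ι] (M : Matrix ι κ ℂ) (v : ι → ℂ) :
    v ∈ LinearMap.range M.mulVecLin ↔ ∀ y, Mᴴ *ᵥ y = 0 → star y ⬝ᵥ v = 0 := by
  constructor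
  · rintro ⟨u, rfl⟩ y hy
    rw [mulVecLin_apply, star_dotProduct_mulVec_eq, hy, star_zero, zero_dotProduct]
  · intro h
    refine mem_of_forall_orthogonal fun y hy => h y ?_
    rw [← dotProduct_star_self_eq_zero, ← star_dotProduct_mulVec_eq]
    exact hy _ ⟨_, rfl⟩

theorem range_mulVecLin_fromCols [Fintype μ] (M : Matrix ι κ ℂ) (N : Matrix ι μ ℂ) :
    LinearMap.range (fromCols M N).mulVecLin =
      LinearMap.range M.mulVecLin ⊔ LinearMap.range N.mulVecLin := by
  ext v
  simp only [Submodule.mem_sup, LinearMap.mem_range, mulVecLin_apply, fromCols_mulVec]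
  constructor
  · rintro ⟨u, rfl⟩
    exact ⟨_, ⟨_, rfl⟩, _, ⟨_, rfl⟩, rfl⟩
  · rintro ⟨_, ⟨u, rfl⟩, _, ⟨w, rfl⟩, rfl⟩
    exact ⟨Sum.elim u w, by simp⟩

theorem ker_mulVecLin_fromRows (M : Matrix ι κ ℂ) (N : Matrix μ κ ℂ) :
    LinearMap.ker (fromRows M N).mulVecLin =
      LinearMap.ker M.mulVecLin ⊓ LinearMap.ker N.mulVecLin := by
  ext v
  simp only [Submodule.mem_inf, LinearMap.mem_ker, mulVecLin_apply, fromRows_mulVec]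
  exact ⟨fun h => ⟨funext fun i => congrFun h (.inl i), funext fun i => congrFun h (.inr i)⟩,
    fun h => by rw [h.1, h.2]; ext (i | i) <;> rfl⟩

theorem finrank_map_add_finrank_inf_ker {X Y : Type*} [AddCommGroup X] [Module ℂ X]
    [FiniteDimensional ℂ X] [AddCommGroup Y] [Module ℂ Y] (g : X →ₗ[ℂ] Y) (U : Submodule ℂ X) :
    finrank ℂ (U.map g) + finrank ℂ (U ⊓ LinearMap.ker g : Submodule ℂ X) = finrank ℂ U := by
  rw [← (g.domRestrict U).finrank_range_add_finrank_ker, LinearMap.range_domRestrict,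
    LinearMap.ker_domRestrict, ← Submodule.map_comap_subtype, Submodule.finrank_map_subtype_eq]

theorem exists_le_finrank_eq {X : Type*} [AddCommGroup X] [Module ℂ X] [FiniteDimensional ℂ X]
    (U : Submodule ℂ X) {k : ℕ} (hU : finrank ℂ U ≤ k) (hk : k ≤ finrank ℂ X) :
    ∃ N : Submodule ℂ X, U ≤ N ∧ finrank ℂ N = k := by
  induction k, hU using Nat.le_induction with
  | base => exact ⟨U, le_rfl, rfl⟩
  | succ k _ ih =>
    obtain ⟨N, hUN, hN⟩ := ih (by omega)
    obtain ⟨v, hv⟩ : ∃ v, v ∉ N := by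
      by_contra! h
      have : N = ⊤ := eq_top_iff.2 fun v _ => h v
      rw [this, finrank_top] at hN
      omega
    refine ⟨N ⊔ ℂ ∙ v, hUN.trans le_sup_left, ?_⟩
    have hd : N ⊓ ℂ ∙ v = ⊥ := by
      rw [← disjoint_iff, Submodule.disjoint_span_singleton' (by rintro rfl; exact hv N.zero_mem)]
      exact hv
    have := Submodule.finrank_sup_add_finrank_inf_eq N (ℂ ∙ v)
    rw [hd, finrank_bot, finrank_span_singleton (by rintro rfl; exact hv N.zero_mem), hN] at this
    omega

theorem exists_matrix_ker_eq [Fintype ι] [DecidableEq ι] (N : Submodule ℂ (ι → ℂ)) :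
    ∃ M : Matrix ι ι ℂ, LinearMap.ker M.mulVecLin = N := by
  obtain ⟨N', h⟩ := N.exists_isCompl
  refine ⟨LinearMap.toMatrix' (N'.projectionOnto N h.symm |> N'.subtype.comp), ?_⟩
  rw [← toLin'_apply', toLin'_toMatrix', LinearMap.ker_comp_of_ker_eq_bot _ (Submodule.ker_subtype _),
    Submodule.ker_projectionOnto]

/-- This is `(ker Mᴴ)ᗮ = range M`. It lets `Tᴴ` act as the quotient map modulo `range M`. -/
theorem ker_eq_range_of_isLeftNullMatrix [Fintype ι] {k : ℕ} {M : Matrix ι κ ℂ} {T : Matrix ι (Fin k) ℂ}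
    (hT : IsLeftNullMatrix M T) :
    LinearMap.ker Tᴴ.mulVecLin = LinearMap.range M.mulVecLin := by
  have hr : LinearMap.range T.mulVecLin = LinearMap.ker Mᴴ.mulVecLin := by
    rw [range_mulVecLin]; exact hT.2
  ext v
  rw [mem_range_mulVecLin_iff, LinearMap.mem_ker, mulVecLin_apply]
  constructor
  · intro h y hy
    obtain ⟨u, rfl⟩ : y ∈ LinearMap.range T.mulVecLin := hr ▸ hy
    refine star_dotProduct_eq_zero_comm ?_
    rw [mulVecLin_apply, star_dotProduct_mulVec_eq, h, star_zero, zero_dotProduct]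
  · intro h
    -- Pairing `v` with `T Tᴴ v` gives the squared norm of `Tᴴ v`.
    have := h (T *ᵥ (Tᴴ *ᵥ v)) (by
      have : T *ᵥ (Tᴴ *ᵥ v) ∈ LinearMap.ker Mᴴ.mulVecLin := hr ▸ ⟨_, rfl⟩
      exact this)
    have := star_dotProduct_eq_zero_comm this
    rwa [star_dotProduct_mulVec_eq, dotProduct_star_self_eq_zero] at this

theorem range_eq_ker_of_isRightNullMatrix {k : ℕ} {M : Matrix ι κ ℂ} {S : Matrix κ (Fin k) ℂ}
    (hS : IsRightNullMatrix M S) :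
    LinearMap.range S.mulVecLin = LinearMap.ker M.mulVecLin := by
  rw [range_mulVecLin]; exact hS.2

end LinearAlgebra

/-! ### Regularity and index at most one as a kernel condition. -/

section Pencil

open Module

variable {n : ℕ}

/-- Regularity and index at most one in coordinate free form: `A` maps no nonzero vector of the
kernel of `E` into the range of `E`. -/
def KernelNondegenerate (E A : Matrix (Fin n) (Fin n) ℂ) : Prop :=
  ∀ x, E *ᵥ x = 0 → A *ᵥ x ∈ LinearMap.range E.mulVecLin → x = 0

theorem blockDiagonal'_nilBlock_eq_zero {k : ℕ} {σ : Fin k → ℕ} (hσ : ∀ j, σ j ≤ 1) :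
    (blockDiagonal' fun j => nilBlock (σ j)) = 0 := by
  ext ⟨j, i⟩ ⟨j', i'⟩
  by_cases h : j = j'
  · subst h
    have := hσ j
    simp only [blockDiagonal'_apply_eq, nilBlock, of_apply, Matrix.zero_apply, ite_eq_right_iff]
    omega
  · rw [blockDiagonal'_apply_ne _ _ _ h, Matrix.zero_apply]

/-- Nilpotent blocks of size one are zero, so the pair becomes `diag (1, 0)`, `diag (Λ, 1)`. The
first matrix kills the first component of a kernel vector, the second one its other component. -/
theorem KernelNondegenerate.of_pencilIndexLeOne {E A : Matrix (Fin n) (Fin n) ℂ}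
    (h : PencilIndexLeOne E A) : KernelNondegenerate E A := by
  obtain ⟨ν, ⟨p, k, σ, e, Λ, S, T, -, hS, hT, hSET, hSAT, rfl⟩, hν⟩ := h
  rw [blockDiagonal'_nilBlock_eq_zero fun j => (Finset.le_sup (Finset.mem_univ j)).trans hν]
    at hSET
  have hT' : ∀ x, ∃ y, T *ᵥ y = x := fun x => ⟨T⁻¹ *ᵥ x, by
    rw [mulVec_mulVec, mul_nonsing_inv _ hT, one_mulVec]⟩
  have hre : ∀ (M : Matrix (Fin n) (Fin n) ℂ) (v : Fin n → ℂ),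
      reindex e e M *ᵥ (v ∘ e.symm) = (M *ᵥ v) ∘ e.symm := fun M v => by
    rw [reindex_apply, submatrix_mulVec_equiv]
    simp [Function.comp_assoc]
  intro x hx hAx
  obtain ⟨u, rfl⟩ := hT' x
  obtain ⟨y, hy⟩ := hAx
  obtain ⟨w, rfl⟩ := hT' y
  have h1 := hre (S * E * T) u
  have h2 := hre (S * A * T) u
  have h3 := hre (S * E * T) w
  rw [← mulVec_mulVec, ← mulVec_mulVec, hx, mulVec_zero, hSET, fromBlocks_mulVec] at h1
  rw [← mulVec_mulVec, ← mulVec_mulVec, ← hy, mulVecLin_apply, mulVec_mulVec _ S, mulVec_mulVec,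
    ← h3, hSAT, hSET, fromBlocks_mulVec, fromBlocks_mulVec] at h2
  have hu : u = 0 := by
    funext i
    obtain ⟨j, rfl⟩ := e.symm.surjective i
    rcases j with j | j
    · simpa using congrFun h1 (.inl j)
    · simpa using congrFun h2 (.inr j)
  rw [hu, mulVec_zero]

/-- `A` is injective on `ker E` and the image meets `range E` trivially, so the dimensions add up to
`n`. -/
theorem KernelNondegenerate.map_ker_sup_range {E A : Matrix (Fin n) (Fin n) ℂ}
    (h : KernelNondegenerate E A) :
    (LinearMap.ker E.mulVecLin).map A.mulVecLin ⊔ LinearMap.range E.mulVecLin = ⊤ := by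
  have hd : (LinearMap.ker E.mulVecLin).map A.mulVecLin ⊓ LinearMap.range E.mulVecLin = ⊥ := by
    rw [eq_bot_iff]
    rintro _ ⟨⟨x, hx, rfl⟩, hr⟩
    rw [h x hx hr]
    simp
  have hi : LinearMap.ker E.mulVecLin ⊓ LinearMap.ker A.mulVecLin = ⊥ := by
    rw [eq_bot_iff]
    rintro x ⟨hx, hA⟩
    refine h x hx ?_
    rw [show A *ᵥ x = 0 from hA]
    exact zero_mem _
  have h1 := finrank_map_add_finrank_inf_ker A.mulVecLin (LinearMap.ker E.mulVecLin)
  have h2 := Submodule.finrank_sup_add_finrank_inf_eq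
    ((LinearMap.ker E.mulVecLin).map A.mulVecLin) (LinearMap.range E.mulVecLin)
  have h3 := E.mulVecLin.finrank_range_add_finrank_ker
  rw [hi, finrank_bot] at h1
  rw [hd, finrank_bot] at h2
  exact Submodule.eq_top_of_finrank_eq (by omega)

theorem KernelNondegenerate.isCompl {E A : Matrix (Fin n) (Fin n) ℂ}
    (h : KernelNondegenerate E A) :
    IsCompl ((LinearMap.range E.mulVecLin).comap A.mulVecLin) (LinearMap.ker E.mulVecLin) := by
  constructor
  · rw [Submodule.disjoint_def]
    exact fun x hx hE => h x hE hx
  · rw [codisjoint_iff, eq_top_iff]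
    intro x _
    have hx : A *ᵥ x ∈ (LinearMap.ker E.mulVecLin).map A.mulVecLin ⊔ LinearMap.range E.mulVecLin :=
      h.map_ker_sup_range ▸ Submodule.mem_top
    obtain ⟨_, ⟨y, hy, rfl⟩, z, hz, hyz⟩ := Submodule.mem_sup.1 hx
    refine Submodule.mem_sup.2 ⟨x - y, ?_, y, hy, sub_add_cancel _ _⟩
    rw [Submodule.mem_comap, map_sub]
    simp only [mulVecLin_apply] at hyz ⊢
    rwa [← hyz, add_sub_cancel_left]

/-- Left multiplication by a suitable invertible map turns `E` into the projection onto the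
preimage of `range E` under `A` along `ker E`, and makes `A` respect this decomposition. -/
theorem KernelNondegenerate.exists_linearEquiv {E A : Matrix (Fin n) (Fin n) ℂ}
    (h : KernelNondegenerate E A) :
    ∃ g : (Fin n → ℂ) ≃ₗ[ℂ] (Fin n → ℂ),
      (∀ x ∈ (LinearMap.range E.mulVecLin).comap A.mulVecLin, g (E *ᵥ x) = x ∧
        g (A *ᵥ x) ∈ (LinearMap.range E.mulVecLin).comap A.mulVecLin) ∧
      ∀ x ∈ LinearMap.ker E.mulVecLin, g (A *ᵥ x) = x := by
  set C := (LinearMap.range E.mulVecLin).comap A.mulVecLin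
  set N := LinearMap.ker E.mulVecLin
  have hc : IsCompl C N := h.isCompl
  set π : (Fin n → ℂ) →ₗ[ℂ] (Fin n → ℂ) := C.projection N hc
  have hπC : ∀ x ∈ C, π x = x := fun x hx =>
    Submodule.projection_apply_of_mem_left hc hx
  have hπN : ∀ x ∈ N, π x = 0 := fun x hx =>
    (Submodule.projection_apply_eq_zero_iff hc).2 hx
  have hπmem : ∀ x, π x ∈ C := Submodule.projection_apply_mem hc
  have hsub : ∀ x, x - π x ∈ N := fun x => by
    obtain ⟨y, hy, z, hz, rfl⟩ := Submodule.mem_sup.1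
      (hc.sup_eq_top ▸ Submodule.mem_top : x ∈ C ⊔ N)
    rw [map_add, hπC y hy, hπN z hz, add_zero, add_sub_cancel_left]
    exact hz
  have hEπ : ∀ x, E *ᵥ π x = E *ᵥ x := fun x => by
    have : E *ᵥ (x - π x) = 0 := hsub x
    rw [mulVec_sub, sub_eq_zero] at this
    exact this.symm
  -- `G` equals `E` on `C` and `A` on `N`; its inverse is the required left factor.
  set G : (Fin n → ℂ) →ₗ[ℂ] (Fin n → ℂ) :=
    E.mulVecLin ∘ₗ π + A.mulVecLin ∘ₗ (LinearMap.id - π)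
  have hG : ∀ x, G x = E *ᵥ x + A *ᵥ (x - π x) := fun x => by simp [G, hEπ]
  have hGinj : Function.Injective G := by
    rw [injective_iff_map_eq_zero]
    intro x hx
    rw [hG] at hx
    have h0 : x - π x = 0 := h _ (hsub x) ⟨-x, by
      rw [mulVecLin_apply, mulVec_neg, neg_eq_iff_add_eq_zero, hx]⟩
    have hxC : x ∈ C := by rw [sub_eq_zero.1 h0]; exact hπmem x
    rw [h0, mulVec_zero, add_zero] at hx
    exact Submodule.disjoint_def.1 hc.disjoint x hxC hx
  set Gi := LinearEquiv.ofInjectiveEndo G hGinj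
  have hGi : ∀ x, Gi.symm (G x) = x := fun x => Gi.symm_apply_apply x
  have hGE : ∀ x, Gi.symm (E *ᵥ x) = π x := fun x => by
    rw [← hGi (π x), hG, hπC _ (hπmem x), sub_self, mulVec_zero, add_zero, hEπ]
  have hGAN : ∀ x ∈ N, Gi.symm (A *ᵥ x) = x := fun x hx => by
    conv_rhs => rw [← hGi x]
    rw [hG, hπN x hx, sub_zero, show E *ᵥ x = 0 from hx, zero_add]
  have hGAC : ∀ x ∈ C, Gi.symm (A *ᵥ x) ∈ C := fun x ⟨y, hy⟩ => by
    rw [mulVecLin_apply, mulVecLin_apply] at hy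
    rw [← hy, hGE]
    exact hπmem y
  exact ⟨Gi.symm, fun x hx => ⟨by rw [hGE, hπC x hx], hGAC x hx⟩, hGAN⟩

theorem KernelNondegenerate.exists_normal_form {E A : Matrix (Fin n) (Fin n) ℂ}
    (h : KernelNondegenerate E A) :
    ∃ (p k : ℕ) (e : Fin n ≃ Fin p ⊕ (Σ _ : Fin k, Fin 1)) (Λ : Matrix (Fin p) (Fin p) ℂ)
      (S T : Matrix (Fin n) (Fin n) ℂ), IsUnit S.det ∧ IsUnit T.det ∧
      reindex e e (S * E * T) = fromBlocks 1 0 0 0 ∧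
      reindex e e (S * A * T) = fromBlocks Λ 0 0 1 := by
  obtain ⟨g, hgC, hgN⟩ := h.exists_linearEquiv
  have hc := h.isCompl
  generalize (LinearMap.range E.mulVecLin).comap A.mulVecLin = C at hgC hc
  obtain ⟨N, hN⟩ : ∃ N, N = LinearMap.ker E.mulVecLin := ⟨_, rfl⟩
  rw [← hN] at hgN hc
  have hEN : ∀ x ∈ N, E *ᵥ x = 0 := fun x hx => by rw [hN] at hx; exact hx
  obtain ⟨b, hbl, hbr, hrepr⟩ :
      ∃ b : Basis (Fin (finrank ℂ C) ⊕ (Σ _ : Fin (finrank ℂ N), Fin 1)) ℂ (Fin n → ℂ),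
        (∀ i, b (.inl i) ∈ C) ∧ (∀ i, b (.inr i) ∈ N) ∧ ∀ x ∈ C, ∀ i, b.repr x (.inr i) = 0 := by
    refine ⟨(((finBasis ℂ C).prod (finBasis ℂ N)).map
      (Submodule.prodEquivOfIsCompl C N hc)).reindex
      (Equiv.sumCongr (Equiv.refl _) (Equiv.sigmaUnique _ _).symm), ?_, ?_, ?_⟩
    · intro i
      simp
    · intro i
      simp
    · intro x hx i
      have : ((Submodule.prodEquivOfIsCompl C N hc).symm x).2 = 0 :=
        (Submodule.prodEquivOfIsCompl_symm_apply_snd_eq_zero _ _ hc).2 hx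
      rw [Basis.repr_reindex_apply, Basis.map_repr, LinearEquiv.trans_apply]
      change ((finBasis ℂ C).prod (finBasis ℂ N)).repr _ (.inr i.1) = 0
      rw [Basis.prod_repr_inr, this, map_zero, Finsupp.zero_apply]
  obtain ⟨e⟩ : Nonempty (Fin n ≃ Fin (finrank ℂ C) ⊕ (Σ _ : Fin (finrank ℂ N), Fin 1)) :=
    ⟨(Pi.basisFun ℂ (Fin n)).indexEquiv b⟩
  let b' := b.reindex e.symm
  let s := Pi.basisFun ℂ (Fin n)
  -- For the chosen left and right factors, the transformed `M` is the matrix of `g ∘ M` in the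
  -- basis `b` adapted to `C ⊕ N`.
  have key : ∀ M : Matrix (Fin n) (Fin n) ℂ, reindex e e
      (b'.toMatrix s * LinearMap.toMatrix' g.toLinearMap * M * s.toMatrix b') =
      of fun i j => b.repr (g (M *ᵥ b j)) i := fun M => by
    have h1 : LinearMap.toMatrix' g.toLinearMap * M =
        LinearMap.toMatrix s s (g.toLinearMap ∘ₗ M.mulVecLin) := by
      rw [LinearMap.toMatrix_eq_toMatrix', LinearMap.toMatrix'_comp, ← toLin'_apply',
        LinearMap.toMatrix'_toLin']
    rw [Matrix.mul_assoc (b'.toMatrix s), h1,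
      basis_toMatrix_mul_linearMap_toMatrix_mul_basis_toMatrix]
    ext i j
    simp [LinearMap.toMatrix_apply, b']
  have hE : ∀ i, g (E *ᵥ b (.inr i)) = 0 := fun i => by rw [hEN _ (hbr i), map_zero]
  refine ⟨_, _, e, of fun i j => b.repr (g (A *ᵥ b (.inl j))) (.inl i),
    b'.toMatrix s * LinearMap.toMatrix' g.toLinearMap, s.toMatrix b', ?_, ?_, ?_, ?_⟩
  · rw [det_mul]
    refine IsUnit.mul ?_ ?_
    · exact isUnit_det_of_right_inverse (b'.toMatrix_mul_toMatrix_flip s)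
    · exact isUnit_det_of_right_inverse (B := LinearMap.toMatrix' g.symm.toLinearMap) (by
        rw [← LinearMap.toMatrix'_comp]; simp)
  · exact isUnit_det_of_right_inverse (s.toMatrix_mul_toMatrix_flip b')
  · rw [key]
    ext (i | i) (j | j)
    · rw [of_apply, (hgC _ (hbl j)).1, b.repr_self, Finsupp.single_apply, fromBlocks_apply₁₁,
        one_apply]
      simp [eq_comm]
    · rw [of_apply, hE, map_zero]
      rfl
    · rw [of_apply, (hgC _ (hbl j)).1, b.repr_self, Finsupp.single_apply, if_neg (by simp)]
      rfl
    · rw [of_apply, hE, map_zero]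
      rfl
  · rw [key]
    ext (i | i) (j | j)
    · rfl
    · rw [of_apply, hgN _ (hbr j), b.repr_self, Finsupp.single_apply, if_neg (by simp)]
      rfl
    · rw [of_apply, hrepr _ (hgC _ (hbl j)).2]
      rfl
    · rw [of_apply, hgN _ (hbr j), b.repr_self, Finsupp.single_apply, fromBlocks_apply₂₂,
        one_apply]
      simp only [Sum.inr.injEq, eq_comm]

theorem KernelNondegenerate.pencilIndexLeOne {E A : Matrix (Fin n) (Fin n) ℂ}
    (h : KernelNondegenerate E A) : PencilIndexLeOne E A := by
  obtain ⟨p, k, e, Λ, S, T, hS, hT, h1, h2⟩ := h.exists_normal_form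
  refine ⟨_, ⟨p, k, fun _ => 1, e, Λ, S, T, fun _ => one_pos, hS, hT, ?_, h2, rfl⟩,
    Finset.sup_le fun _ _ => le_rfl⟩
  rw [h1, blockDiagonal'_nilBlock_eq_zero fun _ => le_rfl]

theorem KernelNondegenerate.pencilRegular {E A : Matrix (Fin n) (Fin n) ℂ}
    (h : KernelNondegenerate E A) : PencilRegular E A := by
  obtain ⟨p, k, e, Λ, S, T, hS, hT, h1, h2⟩ := h.exists_normal_form
  -- Any `s` off the finite spectrum of `Λ` works, since the other diagonal block of the pencil is
  -- `-1`.
  obtain ⟨s, hs⟩ : ∃ s : ℂ, (s • 1 - Λ).det ≠ 0 := by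
    obtain ⟨s, hs⟩ := Infinite.exists_notMem_finset Λ.charpoly.roots.toFinset
    refine ⟨s, fun h0 => hs ?_⟩
    rw [Multiset.mem_toFinset, Polynomial.mem_roots Λ.charpoly_monic.ne_zero, Polynomial.IsRoot,
      eval_charpoly, ← h0, smul_one_eq_diagonal]
    rfl
  refine ⟨s, fun h0 => ?_⟩
  have h3 : reindex e e (S * (s • E - A) * T) = fromBlocks (s • 1 - Λ) 0 0 (-1) := by
    have : S * (s • E - A) * T = s • (S * E * T) - S * A * T := by
      simp [Matrix.mul_sub, Matrix.sub_mul]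
    rw [this]
    have h4 : reindex e e (s • (S * E * T) - S * A * T) =
        s • reindex e e (S * E * T) - reindex e e (S * A * T) := rfl
    rw [h4, h1, h2, fromBlocks_smul, sub_eq_add_neg, fromBlocks_neg, fromBlocks_add]
    simp [sub_eq_add_neg]
  have h4 := congrArg det h3
  rw [det_reindex_self, det_mul, det_mul, h0, det_fromBlocks_zero₂₁, det_neg, det_one] at h4
  simp [hs] at h4

end Pencil

/-! ### The rank conditions as statements about subspaces. -/

section Conditions

open Module

theorem rank_mul_eq_finrank_map {ι κ μ : Type*} [Fintype κ] [Fintype μ]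
    (M : Matrix ι κ ℂ) (P : Matrix κ μ ℂ) :
    (M * P).rank = finrank ℂ ((LinearMap.range P.mulVecLin).map M.mulVecLin) := by
  rw [Matrix.rank, mulVecLin_mul, LinearMap.range_comp]

/-- Since `ker Tᴴ = range M`, the multiplication by `Tᴴ` loses exactly `range P ∩ range M`. -/
theorem rank_leftNull_mul_add {ι κ μ : Type*} [Fintype ι] [Fintype κ] [Fintype μ] {k : ℕ}
    {M : Matrix ι κ ℂ} {T : Matrix ι (Fin k) ℂ} (hT : IsLeftNullMatrix M T) (P : Matrix ι μ ℂ) :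
    (Tᴴ * P).rank +
      finrank ℂ (LinearMap.range P.mulVecLin ⊓ LinearMap.range M.mulVecLin :
        Submodule ℂ (ι → ℂ)) = P.rank := by
  rw [rank_mul_eq_finrank_map, ← ker_eq_range_of_isLeftNullMatrix hT,
    finrank_map_add_finrank_inf_ker, Matrix.rank]

variable {n m : ℕ} {E A : Matrix (Fin n) (Fin n) ℂ} {B : Matrix (Fin n) (Fin m) ℂ}

theorem rank_fromCols_fromCols_eq_iff :
    (fromCols (fromCols E A) B).rank = n ↔
      LinearMap.range A.mulVecLin ⊔ LinearMap.range (fromCols E B).mulVecLin = ⊤ := by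
  have : LinearMap.range (fromCols (fromCols E A) B).mulVecLin =
      LinearMap.range A.mulVecLin ⊔ LinearMap.range (fromCols E B).mulVecLin := by
    simp only [range_mulVecLin_fromCols]
    ac_rfl
  rw [← this, Matrix.rank]
  constructor
  · intro h
    exact Submodule.eq_top_of_finrank_eq (by rw [h, finrank_fin_fun])
  · intro h
    rw [h, finrank_top, finrank_fin_fun]

/-- The right side of the rank equation is `rank (T₁ᴴ E)`, and `range S₂` is the preimage of `range
[E, B]` under `A`. The equation thus says that `T₁ᴴ E` already attains its full range on that
preimage. -/
theorem rank_leftNull_mul_mul_rightNull_eq_iff {a b c : ℕ}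
    {T₁ : Matrix (Fin n) (Fin a) ℂ} (hT₁ : IsLeftNullMatrix B T₁)
    {T₂ : Matrix (Fin n) (Fin b) ℂ} (hT₂ : IsLeftNullMatrix (fromCols E B) T₂)
    {S₂ : Matrix (Fin n) (Fin c) ℂ} (hS₂ : IsRightNullMatrix (T₂ᴴ * A) S₂) :
    ((T₁ᴴ * E * S₂).rank : ℤ) = (fromCols E B).rank - B.rank ↔
      ∀ x, ∃ u, A *ᵥ u ∈ LinearMap.range (fromCols E B).mulVecLin ∧
        E *ᵥ (x - u) ∈ LinearMap.range B.mulVecLin := by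
  have hU : ∀ u, u ∈ LinearMap.range S₂.mulVecLin ↔
      A *ᵥ u ∈ LinearMap.range (fromCols E B).mulVecLin := fun u => by
    rw [range_eq_ker_of_isRightNullMatrix hS₂, ← ker_eq_range_of_isLeftNullMatrix hT₂,
      LinearMap.mem_ker, LinearMap.mem_ker, mulVecLin_apply, mulVecLin_apply, mulVec_mulVec]
  have hW : ∀ x, x ∈ LinearMap.range B.mulVecLin ↔ T₁ᴴ *ᵥ x = 0 := fun x => by
    rw [← ker_eq_range_of_isLeftNullMatrix hT₁, LinearMap.mem_ker, mulVecLin_apply]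
  have h1 := rank_leftNull_mul_add hT₁ E
  have h2 := Submodule.finrank_sup_add_finrank_inf_eq (LinearMap.range E.mulVecLin)
    (LinearMap.range B.mulVecLin)
  rw [← range_mulVecLin_fromCols] at h2
  have h3 : (fromCols E B).rank = (T₁ᴴ * E).rank + B.rank := by
    simp only [Matrix.rank] at *
    omega
  rw [h3, Nat.cast_add, add_sub_cancel_right, Nat.cast_inj, rank_mul_eq_finrank_map]
  have hle : (LinearMap.range S₂.mulVecLin).map (T₁ᴴ * E).mulVecLin ≤
    LinearMap.range (T₁ᴴ * E).mulVecLin := LinearMap.map_le_range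
  have hiff : ∀ x u, (T₁ᴴ * E) *ᵥ u = (T₁ᴴ * E) *ᵥ x ↔
      E *ᵥ (x - u) ∈ LinearMap.range B.mulVecLin := fun x u => by
    rw [hW, mulVec_mulVec, mulVec_sub, sub_eq_zero, eq_comm]
  constructor
  · intro h x
    have hx : (T₁ᴴ * E) *ᵥ x ∈ (LinearMap.range S₂.mulVecLin).map (T₁ᴴ * E).mulVecLin := by
      rw [Submodule.eq_of_le_of_finrank_eq hle h]
      exact ⟨x, rfl⟩
    obtain ⟨u, hu, hux⟩ := hx
    exact ⟨u, (hU u).1 hu, (hiff x u).1 hux⟩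
  · intro h
    rw [Matrix.rank, le_antisymm hle]
    rintro _ ⟨x, rfl⟩
    obtain ⟨u, hu, hux⟩ := h x
    exact ⟨u, (hU u).2 hu, (hiff x u).2 hux⟩

/-- The two rank conditions together, in coordinate free form. -/
theorem rank_conditions_iff {a b c : ℕ}
    {T₁ : Matrix (Fin n) (Fin a) ℂ} (hT₁ : IsLeftNullMatrix B T₁)
    {T₂ : Matrix (Fin n) (Fin b) ℂ} (hT₂ : IsLeftNullMatrix (fromCols E B) T₂)
    {S₂ : Matrix (Fin n) (Fin c) ℂ} (hS₂ : IsRightNullMatrix (T₂ᴴ * A) S₂) :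
    ((fromCols (fromCols E A) B).rank = n ∧
      ((T₁ᴴ * E * S₂).rank : ℤ) = (fromCols E B).rank - B.rank) ↔
      ((LinearMap.range B.mulVecLin).comap E.mulVecLin).map A.mulVecLin ⊔
        LinearMap.range (fromCols E B).mulVecLin = ⊤ := by
  rw [rank_fromCols_fromCols_eq_iff, rank_leftNull_mul_mul_rightNull_eq_iff hT₁ hT₂ hS₂]
  constructor
  · rintro ⟨h1, h2⟩
    rw [eq_top_iff, ← h1, sup_le_iff]
    refine ⟨?_, le_sup_right⟩
    rintro _ ⟨x, rfl⟩
    obtain ⟨u, hu, hux⟩ := h2 x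
    exact Submodule.mem_sup.2 ⟨_, ⟨x - u, hux, rfl⟩, _, hu, by
      simp only [mulVecLin_apply, mulVec_sub, sub_add_cancel]⟩
  · intro h
    constructor
    · rw [eq_top_iff, ← h]
      exact sup_le_sup_right LinearMap.map_le_range _
    · intro x
      obtain ⟨_, ⟨y, hy, rfl⟩, v, hv, hxv⟩ := Submodule.mem_sup.1
        (h ▸ Submodule.mem_top : A *ᵥ x ∈ _)
      refine ⟨x - y, ?_, by rw [sub_sub_cancel]; exact hy⟩
      rw [mulVec_sub, ← hxv, mulVecLin_apply, add_sub_cancel_left]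
      exact hv

end Conditions

/-! ### What every regularizing feedback forces. -/

section Necessity

open Module

variable {n m : ℕ} {E A : Matrix (Fin n) (Fin n) ℂ} {B : Matrix (Fin n) (Fin m) ℂ}

theorem add_mul_mul_mulVec (P : Matrix (Fin n) (Fin n) ℂ) (K : Matrix (Fin m) (Fin m) ℂ)
    (B' : Matrix (Fin m) (Fin n) ℂ) (x : Fin n → ℂ) :
    (P + B * K * B') *ᵥ x = P *ᵥ x + B *ᵥ (K *ᵥ (B' *ᵥ x)) := by
  rw [add_mulVec, mulVec_mulVec, mulVec_mulVec, Matrix.mul_assoc]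

theorem range_fromCols_eq_of_feedback (K : Matrix (Fin m) (Fin m) ℂ) :
    LinearMap.range (fromCols E B).mulVecLin =
      LinearMap.range (E + B * K * Bᴴ).mulVecLin ⊔ LinearMap.range B.mulVecLin := by
  rw [range_mulVecLin_fromCols]
  apply le_antisymm <;> refine sup_le ?_ le_sup_right <;> rintro _ ⟨x, rfl⟩ <;>
    refine Submodule.mem_sup.2 ?_
  · refine ⟨_, ⟨x, rfl⟩, _, ⟨-(K *ᵥ (Bᴴ *ᵥ x)), rfl⟩, ?_⟩
    simp only [mulVecLin_apply, add_mul_mul_mulVec, mulVec_neg, add_neg_cancel_right]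
  · refine ⟨_, ⟨x, rfl⟩, _, ⟨K *ᵥ (Bᴴ *ᵥ x), rfl⟩, ?_⟩
    simp only [mulVecLin_apply, add_mul_mul_mulVec]

/-- If `(E + B K Bᴴ) x = 0`, then `E x` lies in `range B`; the change of `A x` by the feedback is
absorbed in `range B` as well. -/
theorem map_sup_range_eq_top_of_feedback {K F : Matrix (Fin m) (Fin m) ℂ}
    (h : KernelNondegenerate (E + B * K * Bᴴ) (A + B * F * Bᴴ)) :
    ((LinearMap.range B.mulVecLin).comap E.mulVecLin).map A.mulVecLin ⊔
        LinearMap.range (fromCols E B).mulVecLin = ⊤ := by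
  rw [eq_top_iff, ← h.map_ker_sup_range, range_fromCols_eq_of_feedback K]
  refine sup_le ?_ (le_sup_left.trans le_sup_right)
  rintro _ ⟨x, hx, rfl⟩
  refine Submodule.mem_sup.2 ⟨A *ᵥ x, ⟨x, ⟨-(K *ᵥ (Bᴴ *ᵥ x)), ?_⟩, rfl⟩, B *ᵥ (F *ᵥ (Bᴴ *ᵥ x)),
    Submodule.mem_sup_right ⟨_, rfl⟩, ?_⟩
  · have hx' : (E + B * K * Bᴴ) *ᵥ x = 0 := hx
    rw [add_mul_mul_mulVec, add_eq_zero_iff_eq_neg] at hx'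
    rw [mulVecLin_apply, mulVecLin_apply, hx', mulVec_neg]
  · rw [mulVecLin_apply, add_mul_mul_mulVec]

theorem rank_fromCols_le_of_feedback (K : Matrix (Fin m) (Fin m) ℂ) :
    (fromCols E B).rank ≤ (E + B * K * Bᴴ).rank + B.rank := by
  rw [Matrix.rank, range_fromCols_eq_of_feedback K]
  exact Submodule.finrank_add_le_finrank_add_finrank _ _

/-- On `ker E ∩ ker Bᴴ` the feedback is invisible, so the image of this space under `A` meets the
closed-loop range only in zero. Both spaces being compared lie in `range [E, B]`. -/
theorem rank_feedback_add_le {K F : Matrix (Fin m) (Fin m) ℂ}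
    (h : KernelNondegenerate (E + B * K * Bᴴ) (A + B * F * Bᴴ)) :
    (E + B * K * Bᴴ).rank + finrank ℂ (LinearMap.range (fromCols E B).mulVecLin ⊓
      (LinearMap.ker E.mulVecLin ⊓ LinearMap.ker Bᴴ.mulVecLin).map A.mulVecLin :
        Submodule ℂ (Fin n → ℂ)) ≤ (fromCols E B).rank := by
  set V := LinearMap.range (fromCols E B).mulVecLin with hV
  set Y := (LinearMap.ker E.mulVecLin ⊓ LinearMap.ker Bᴴ.mulVecLin).map A.mulVecLin
  have hd : LinearMap.range (E + B * K * Bᴴ).mulVecLin ⊓ (V ⊓ Y) = ⊥ := by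
    rw [eq_bot_iff]
    rintro _ ⟨hr, -, x, ⟨hE, hB⟩, rfl⟩
    have hE' : E *ᵥ x = 0 := hE
    have hB' : Bᴴ *ᵥ x = 0 := hB
    have hx : x = 0 := by
      refine h x ?_ ?_
      · rw [add_mul_mul_mulVec, hE', hB', mulVec_zero, mulVec_zero, add_zero]
      · rw [add_mul_mul_mulVec, hB', mulVec_zero, mulVec_zero, add_zero]
        exact hr
    rw [hx, map_zero]
    exact zero_mem _
  have h1 := Submodule.finrank_sup_add_finrank_inf_eq
    (LinearMap.range (E + B * K * Bᴴ).mulVecLin) (V ⊓ Y)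
  rw [hd, finrank_bot, add_zero] at h1
  rw [Matrix.rank, ← h1, Matrix.rank, ← hV]
  refine Submodule.finrank_mono (sup_le ?_ inf_le_left)
  rw [hV, range_fromCols_eq_of_feedback K]
  exact le_sup_left

end Necessity

/-! ### Consequences of positivity and dissipation. -/

section Passivity

variable {ι κ : Type*} [Fintype ι] [Fintype κ]

theorem mulVec_eq_zero_of_add_conjTranspose_mul_self {P : Matrix ι ι ℂ} (hP : P.PosSemidef)
    (Q : Matrix κ ι ℂ) {x : ι → ℂ} (h : (P + Qᴴ * Q) *ᵥ x = 0) : P *ᵥ x = 0 ∧ Q *ᵥ x = 0 := by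
  have h1 : star x ⬝ᵥ (P *ᵥ x) + star x ⬝ᵥ ((Qᴴ * Q) *ᵥ x) = 0 := by
    rw [← dotProduct_add, ← add_mulVec, h, dotProduct_zero]
  have hQ := posSemidef_conjTranspose_mul_self Q
  have h2 := (add_eq_zero_iff_of_nonneg (hP.dotProduct_mulVec_nonneg x)
    (hQ.dotProduct_mulVec_nonneg x)).1 h1
  exact ⟨(hP.dotProduct_mulVec_zero_iff x).1 h2.1,
    (conjTranspose_mul_self_mulVec_eq_zero Q x).1 ((hQ.dotProduct_mulVec_zero_iff x).1 h2.2)⟩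

/-- `xᴴ J x` is imaginary and `xᴴ P x` is real, so both vanish when they are equal. -/
theorem mulVec_eq_zero_of_skew_sub_posSemidef {J P : Matrix ι ι ℂ} (hJ : J = -Jᴴ)
    (hP : P.PosSemidef) {x : ι → ℂ} (h : star x ⬝ᵥ ((J - P) *ᵥ x) = 0) : P *ᵥ x = 0 := by
  rw [← hP.dotProduct_mulVec_zero_iff]
  have hn := hP.dotProduct_mulVec_nonneg x
  rw [sub_mulVec, dotProduct_sub, sub_eq_zero] at h
  have hj : star (star x ⬝ᵥ (J *ᵥ x)) = -(star x ⬝ᵥ (J *ᵥ x)) := by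
    have h1 : star x ⬝ᵥ (J *ᵥ x) = -(star (J *ᵥ x) ⬝ᵥ x) := by
      rw [star_dotProduct_mulVec_eq]
      conv_rhs => rw [hJ, neg_mulVec, star_neg, neg_dotProduct, neg_neg]
    have h2 : star (J *ᵥ x) ⬝ᵥ x = star (star x ⬝ᵥ (J *ᵥ x)) := by
      rw [← star_dotProduct_star, star_star]
    rw [← h2, h1, neg_neg]
  rw [h] at hj
  have him : star (star x ⬝ᵥ (P *ᵥ x)) = star x ⬝ᵥ (P *ᵥ x) := IsSelfAdjoint.of_nonneg hn
  rw [him] at hj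
  exact self_eq_neg.1 hj

end Passivity

/-! ### Construction of the feedbacks. -/

section Sufficiency

open Module

variable {n m : ℕ} {E : Matrix (Fin n) (Fin n) ℂ} {B : Matrix (Fin n) (Fin m) ℂ}

theorem star_dotProduct_eq_zero_of_mem_range_fromCols (hE : E.PosSemidef) {x v : Fin n → ℂ}
    (hx : E *ᵥ x = 0) (hBx : Bᴴ *ᵥ x = 0) (hv : v ∈ LinearMap.range (fromCols E B).mulVecLin) :
    star x ⬝ᵥ v = 0 := by
  rw [range_mulVecLin_fromCols] at hv
  obtain ⟨_, ⟨u, rfl⟩, _, ⟨w, rfl⟩, rfl⟩ := Submodule.mem_sup.1 hv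
  rw [dotProduct_add, mulVecLin_apply, mulVecLin_apply, star_dotProduct_mulVec_eq, hE.1.eq, hx,
    star_dotProduct_mulVec_eq, hBx]
  simp

theorem mulVec_eq_zero_of_mem_range_of_mem_ker (hE : E.PosSemidef) {x : Fin n → ℂ}
    (hx : E *ᵥ x ∈ LinearMap.range B.mulVecLin) (hBx : Bᴴ *ᵥ x = 0) : E *ᵥ x = 0 := by
  rw [← hE.dotProduct_mulVec_zero_iff]
  obtain ⟨c, hc⟩ := hx
  rw [← hc, mulVecLin_apply, star_dotProduct_mulVec_eq, hBx, star_zero, zero_dotProduct]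

/-- The orthogonal complement of `E⁻¹(range B)` lies in `E (ker Bᴴ)`. A vector `E z` there with `z ∈
ker Bᴴ` that is also orthogonal to `ker Bᴴ` has `zᴴ E z = 0`, hence is zero. -/
theorem comap_range_sup_ker_eq_top (hE : E.PosSemidef) :
    (LinearMap.range B.mulVecLin).comap E.mulVecLin ⊔ LinearMap.ker Bᴴ.mulVecLin = ⊤ := by
  refine eq_top_of_forall_orthogonal fun y hy => ?_
  have hyE : y ∈ (LinearMap.ker Bᴴ.mulVecLin).map E.mulVecLin := by
    refine mem_of_forall_orthogonal fun w hw => star_dotProduct_eq_zero_comm ?_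
    refine hy w (Submodule.mem_sup_left ((mem_range_mulVecLin_iff _ _).2 fun z hz => ?_))
    rw [mulVecLin_apply, star_dotProduct_mulVec_eq, hE.1.eq]
    exact star_dotProduct_eq_zero_comm (hw _ ⟨z, hz, rfl⟩)
  obtain ⟨z, hz, rfl⟩ := hyE
  exact (hE.dotProduct_mulVec_zero_iff z).1
    (star_dotProduct_eq_zero_comm (hy z (Submodule.mem_sup_right hz)))

/-- A right inverse `G` of `Bᴴ` such that `E` maps the range of `G` into the range of `B`. -/
theorem exists_right_inverse_conjTranspose (hE : E.PosSemidef) (hB : B.rank = m) :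
    ∃ G : Matrix (Fin n) (Fin m) ℂ, Bᴴ * G = 1 ∧ E * G = B * (Gᴴ * E * G) := by
  have hsurj : LinearMap.range Bᴴ.mulVecLin = ⊤ :=
    Submodule.eq_top_of_finrank_eq (by
      rw [finrank_fin_fun]
      exact (rank_conjTranspose B).trans hB)
  have hex : ∀ w : Fin m → ℂ, ∃ x, Bᴴ *ᵥ x = w ∧ ∃ c, B *ᵥ c = E *ᵥ x := by
    intro w
    obtain ⟨x, hx⟩ : w ∈ LinearMap.range Bᴴ.mulVecLin := hsurj ▸ Submodule.mem_top
    obtain ⟨y, hy, z, hz, rfl⟩ := Submodule.mem_sup.1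
      (comap_range_sup_ker_eq_top (B := B) hE ▸ Submodule.mem_top : x ∈ _)
    have hz' : Bᴴ *ᵥ z = 0 := hz
    -- Discarding the component in `ker Bᴴ` leaves the value of `Bᴴ` unchanged.
    refine ⟨y, ?_, hy⟩
    rw [← hx, mulVecLin_apply, mulVec_add, hz', add_zero]
  choose g hg c hc using fun j => hex (Pi.single j 1)
  have hG : Bᴴ * (of g)ᵀ = 1 := by
    ext i j
    refine (congrFun (hg j) i).trans ?_
    rw [Pi.single_apply, one_apply]
  have hC : E * (of g)ᵀ = B * (of c)ᵀ := by
    ext i j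
    exact (congrFun (hc j) i).symm
  refine ⟨_, hG, ?_⟩
  -- Multiplying `E G = B C` by `Gᴴ` on the left identifies `C` as `Gᴴ E G`.
  have hG' : (of g)ᵀᴴ * B = 1 := by
    rw [← conjTranspose_conjTranspose B, ← conjTranspose_mul, hG, conjTranspose_one]
  rw [Matrix.mul_assoc (_ᴴ), hC, ← Matrix.mul_assoc (_ᴴ), hG', Matrix.one_mul]

/-- The feedback that makes the rank of `E` minimal keeps it positive semidefinite. -/
theorem posSemidef_sub_shorted (hE : E.PosSemidef) {G : Matrix (Fin n) (Fin m) ℂ}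
    (hG : Bᴴ * G = 1) (hEG : E * G = B * (Gᴴ * E * G)) :
    (E - B * (Gᴴ * E * G) * Bᴴ).PosSemidef := by
  have hG' : Gᴴ * B = 1 := by
    rw [← conjTranspose_conjTranspose B, ← conjTranspose_mul, hG, conjTranspose_one]
  have hGE : Gᴴ * E = (Gᴴ * E * G) * Bᴴ := by
    have := congrArg conjTranspose hEG
    simp only [conjTranspose_mul, conjTranspose_conjTranspose, hE.1.eq] at this
    rwa [← Matrix.mul_assoc Gᴴ E G] at this
  -- The difference is the congruence of `E` by the projection onto `ker Bᴴ` along `range G`.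
  have h := hE.conjTranspose_mul_mul_same (1 - G * Bᴴ)
  have h2 : (1 - G * Bᴴ)ᴴ * E * (1 - G * Bᴴ) = E - B * (Gᴴ * E * G) * Bᴴ := by
    rw [conjTranspose_sub, conjTranspose_one, conjTranspose_mul, conjTranspose_conjTranspose,
      Matrix.sub_mul, Matrix.one_mul, Matrix.mul_assoc B, Matrix.mul_sub, Matrix.mul_one,
      Matrix.sub_mul, ← Matrix.mul_assoc E, hEG, Matrix.mul_assoc B (Gᴴ * E) (G * Bᴴ),
      ← Matrix.mul_assoc (Gᴴ * E) G Bᴴ, Matrix.mul_assoc B _ Bᴴ, sub_self, sub_zero,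
      ← hGE]
  rwa [h2] at h

/-- Feedbacks that regularize, with the kernel of `E + B K Bᴴ` prescribed by a subspace `N`. -/
theorem exists_isRegularizingFeedback {J R : Matrix (Fin n) (Fin n) ℂ} (hE : E.PosSemidef)
    (hJ : J = -Jᴴ) (hR : R.PosSemidef) {G : Matrix (Fin n) (Fin m) ℂ}
    (hG : Bᴴ * G = 1) (hEG : E * G = B * (Gᴴ * E * G))
    (hC : ((LinearMap.range B.mulVecLin).comap E.mulVecLin).map (J - R).mulVecLin ⊔
      LinearMap.range (fromCols E B).mulVecLin = ⊤)
    {N : Submodule ℂ (Fin m → ℂ)}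
    (hN : (LinearMap.range (fromCols E B).mulVecLin ⊓
      (LinearMap.ker E.mulVecLin ⊓ LinearMap.ker Bᴴ.mulVecLin).map (J - R).mulVecLin).map
        Gᴴ.mulVecLin ≤ N) :
    ∃ K F_S F_H : Matrix (Fin m) (Fin m) ℂ, IsRegularizingFeedback E J R B K F_S F_H ∧
      (E + B * K * Bᴴ).rank + finrank ℂ N = (fromCols E B).rank := by
  obtain ⟨M, rfl⟩ := exists_matrix_ker_eq N
  set E₀ := E - B * (Gᴴ * E * G) * Bᴴ with hE₀
  have hE₀p : E₀.PosSemidef := posSemidef_sub_shorted hE hG hEG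
  have hE₀x : ∀ x, E₀ *ᵥ x = E *ᵥ x - B *ᵥ ((Gᴴ * E * G) *ᵥ (Bᴴ *ᵥ x)) := fun x => by
    rw [hE₀, sub_mulVec, mulVec_mulVec, mulVec_mulVec, Matrix.mul_assoc]
  have hGx : ∀ w, Bᴴ *ᵥ (G *ᵥ w) = w := fun w => by rw [mulVec_mulVec, hG, one_mulVec]
  have hEGx : ∀ w, E *ᵥ (G *ᵥ w) = B *ᵥ ((Gᴴ * E * G) *ᵥ w) := fun w => by
    rw [mulVec_mulVec, hEG, mulVec_mulVec]
  -- The second term removes what `E` does on `range G`; the first restores positivity off `ker M`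
  -- there.
  set K := Mᴴ * M - Gᴴ * E * G with hK
  have hE' : E + B * K * Bᴴ = E₀ + (M * Bᴴ)ᴴ * (M * Bᴴ) := by
    rw [hK, hE₀, Matrix.mul_sub, Matrix.sub_mul, conjTranspose_mul, conjTranspose_conjTranspose]
    simp only [Matrix.mul_assoc]
    abel
  have hE'p : (E + B * K * Bᴴ).PosSemidef := by
    rw [hE']
    exact hE₀p.add (posSemidef_conjTranspose_mul_self _)
  have hker : ∀ x, (E + B * K * Bᴴ) *ᵥ x = 0 ↔ E₀ *ᵥ x = 0 ∧ M *ᵥ (Bᴴ *ᵥ x) = 0 := by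
    intro x
    rw [hE', mulVec_mulVec]
    refine ⟨mulVec_eq_zero_of_add_conjTranspose_mul_self hE₀p _, fun h => ?_⟩
    rw [add_mulVec, h.1, ← mulVec_mulVec, h.2, mulVec_zero, add_zero]
  have hGker : ∀ w, M *ᵥ w = 0 → (E + B * K * Bᴴ) *ᵥ (G *ᵥ w) = 0 := fun w hw => by
    rw [hker, hE₀x, hGx, hEGx, sub_self]
    exact ⟨rfl, hw⟩
  have hR' : (R + B * (1 : Matrix (Fin m) (Fin m) ℂ) * Bᴴ).PosSemidef := by
    rw [Matrix.mul_one]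
    exact hR.add (posSemidef_self_mul_conjTranspose B)
  have hnd : KernelNondegenerate (E + B * K * Bᴴ)
      (J + B * (0 : Matrix (Fin m) (Fin m) ℂ) * Bᴴ - (R + B * (1 : Matrix (Fin m) (Fin m) ℂ) * Bᴴ)) := by
    intro x hx hAx
    rw [Matrix.mul_zero, Matrix.zero_mul, add_zero] at hAx
    -- The closed-loop `E` is Hermitian, so its range is orthogonal to its kernel. Taking `y = x`
    -- brings in the dissipation, where `F_H = 1` also yields `Bᴴ x = 0`.
    have horth : ∀ y, (E + B * K * Bᴴ) *ᵥ y = 0 →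
        star y ⬝ᵥ ((J - (R + B * (1 : Matrix (Fin m) (Fin m) ℂ) * Bᴴ)) *ᵥ x) = 0 :=
      fun y hy => (mem_range_mulVecLin_iff _ _).1 hAx y (by rw [hE'p.1.eq, hy])
    have hRx : R *ᵥ x = 0 ∧ Bᴴ *ᵥ x = 0 := by
      refine mulVec_eq_zero_of_add_conjTranspose_mul_self hR Bᴴ ?_
      have := mulVec_eq_zero_of_skew_sub_posSemidef hJ hR' (horth x hx)
      rw [Matrix.mul_one] at this
      rwa [conjTranspose_conjTranspose]
    obtain ⟨hRx, hBx⟩ := hRx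
    have hEx : E *ᵥ x = 0 := by
      have := ((hker x).1 hx).1
      rwa [hE₀x, hBx, mulVec_zero, mulVec_zero, sub_zero] at this
    have hA : (J - (R + B * (1 : Matrix (Fin m) (Fin m) ℂ) * Bᴴ)) *ᵥ x = (J - R) *ᵥ x := by
      rw [sub_mulVec, sub_mulVec, add_mul_mul_mulVec, hBx, mulVec_zero, mulVec_zero, add_zero]
    rw [hA] at hAx horth
    have hV : (J - R) *ᵥ x ∈ LinearMap.range (fromCols E B).mulVecLin := by
      rw [range_fromCols_eq_of_feedback K]
      exact Submodule.mem_sup_left hAx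
    -- By `hN`, `w = Gᴴ (J - R) x` lies in `ker M`, so `G w` is in the closed-loop kernel. Its
    -- orthogonality to `(J - R) x` says that `w` has norm zero.
    have hGA : Gᴴ *ᵥ ((J - R) *ᵥ x) = 0 := by
      have h1 : M *ᵥ (Gᴴ *ᵥ ((J - R) *ᵥ x)) = 0 :=
        hN ⟨_, ⟨hV, x, ⟨hEx, hBx⟩, rfl⟩, rfl⟩
      have h2 := star_dotProduct_eq_zero_comm (horth _ (hGker _ h1))
      rwa [star_dotProduct_mulVec_eq, dotProduct_star_self_eq_zero] at h2
    -- Each such `y` is the sum of a vector of `ker E ∩ ker Bᴴ` and the vector `G Bᴴ y`; `(J - R) x`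
    -- is orthogonal to both.
    have hH : ∀ y ∈ (LinearMap.range B.mulVecLin).comap E.mulVecLin,
        star y ⬝ᵥ ((J - R) *ᵥ x) = 0 := by
      rintro y ⟨c, hc⟩
      rw [mulVecLin_apply, mulVecLin_apply] at hc
      have hB0 : Bᴴ *ᵥ (y - G *ᵥ (Bᴴ *ᵥ y)) = 0 := by rw [mulVec_sub, hGx, sub_self]
      have hE0 : E *ᵥ (y - G *ᵥ (Bᴴ *ᵥ y)) = 0 := by
        refine mulVec_eq_zero_of_mem_range_of_mem_ker hE ?_ hB0
        rw [mulVec_sub, hEGx, ← hc, ← mulVec_sub]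
        exact ⟨_, rfl⟩
      have h1 := star_dotProduct_eq_zero_of_mem_range_fromCols hE hE0 hB0 hV
      have h2 : star (G *ᵥ (Bᴴ *ᵥ y)) ⬝ᵥ ((J - R) *ᵥ x) = 0 := by
        refine star_dotProduct_eq_zero_comm ?_
        rw [star_dotProduct_mulVec_eq, hGA, star_zero, zero_dotProduct]
      rwa [star_sub, sub_dotProduct, h2, sub_zero] at h1
    have hAH : (J - R)ᴴ *ᵥ x = -((J - R) *ᵥ x) := by
      have hJ' : Jᴴ = -J := by
        conv_rhs => rw [hJ, neg_neg]
      rw [conjTranspose_sub, hR.1.eq, hJ', sub_mulVec, sub_mulVec, hRx, neg_mulVec, sub_zero,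
        sub_zero]
    -- Decompose `x = (J - R) y + v` by `hC`. Because `R x = 0`, the adjoint of `J - R` acts on `x`
    -- as `-(J - R)`, so `x` is orthogonal to both terms and hence to itself.
    obtain ⟨_, ⟨y, hy, rfl⟩, v, hv, hyv⟩ := Submodule.mem_sup.1
      (hC ▸ Submodule.mem_top : x ∈ _)
    have hxx : star x ⬝ᵥ x = 0 := by
      nth_rw 2 [← hyv]
      rw [dotProduct_add, star_dotProduct_eq_zero_of_mem_range_fromCols hE hEx hBx hv,
        mulVecLin_apply, star_dotProduct_mulVec_eq, hAH, star_neg, neg_dotProduct,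
        star_dotProduct_eq_zero_comm (hH y hy), neg_zero, add_zero]
    exact dotProduct_star_self_eq_zero.1 hxx
  refine ⟨K, 0, 1, ⟨by simp, by simp, hE'p, hR', hnd.pencilRegular, hnd.pencilIndexLeOne⟩, ?_⟩
  -- The closed-loop kernel has image `ker M` under `Bᴴ`, and its part in `ker Bᴴ` is the left
  -- nullspace of `[E, B]`. Rank-nullity then gives the rank formula.
  have h1 : (LinearMap.ker (E + B * K * Bᴴ).mulVecLin).map Bᴴ.mulVecLin =
      LinearMap.ker M.mulVecLin := by
    apply le_antisymm
    · rintro _ ⟨x, hx, rfl⟩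
      exact ((hker x).1 hx).2
    · intro w hw
      exact ⟨G *ᵥ w, hGker w hw, hGx w⟩
  have h2 : LinearMap.ker (E + B * K * Bᴴ).mulVecLin ⊓ LinearMap.ker Bᴴ.mulVecLin =
      LinearMap.ker (fromCols E B)ᴴ.mulVecLin := by
    rw [conjTranspose_fromCols_eq_fromRows_conjTranspose, ker_mulVecLin_fromRows, hE.1.eq]
    ext x
    refine and_congr_left fun hB => ?_
    have hB' : Bᴴ *ᵥ x = 0 := hB
    change (E + B * K * Bᴴ) *ᵥ x = 0 ↔ E *ᵥ x = 0
    rw [add_mul_mul_mulVec, hB', mulVec_zero, mulVec_zero, add_zero]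
  have h3 := finrank_map_add_finrank_inf_ker Bᴴ.mulVecLin
    (LinearMap.ker (E + B * K * Bᴴ).mulVecLin)
  have h4 := (E + B * K * Bᴴ).mulVecLin.finrank_range_add_finrank_ker
  have h5 := (fromCols E B)ᴴ.mulVecLin.finrank_range_add_finrank_ker
  rw [h1, h2] at h3
  rw [← rank_conjTranspose (fromCols E B)]
  simp only [Matrix.rank]
  omega

end Sufficiency

/-! ### Assembly of the theorem. -/

theorem IsRegularizingFeedback.kernelNondegenerate {n m : ℕ} {E J R : Matrix (Fin n) (Fin n) ℂ}
    {B : Matrix (Fin n) (Fin m) ℂ} {K F_S F_H : Matrix (Fin m) (Fin m) ℂ}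
    (h : IsRegularizingFeedback E J R B K F_S F_H) :
    KernelNondegenerate (E + B * K * Bᴴ) (J - R + B * (F_S - F_H) * Bᴴ) := by
  have : J - R + B * (F_S - F_H) * Bᴴ = J + B * F_S * Bᴴ - (R + B * F_H * Bᴴ) := by
    rw [Matrix.mul_sub, Matrix.sub_mul]
    abel
  rw [this]
  exact .of_pencilIndexLeOne h.index_le_one

theorem mainTheorem5 {n m : ℕ} (E J R : Matrix (Fin n) (Fin n) ℂ) (B : Matrix (Fin n) (Fin m) ℂ)
    (hE : E.PosSemidef) (hJ : J = -Jᴴ) (hR : R.PosSemidef) (hB : B.rank = m)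
    {a b c d f : ℕ}
    -- `T₁ = 𝒯_∞(B)`
    (T₁ : Matrix (Fin n) (Fin a) ℂ) (hT₁ : IsLeftNullMatrix B T₁)
    -- `T₂ = 𝒯_∞([E, B])`
    (T₂ : Matrix (Fin n) (Fin b) ℂ) (hT₂ : IsLeftNullMatrix (Matrix.fromCols E B) T₂)
    -- `S₂ = 𝒮_∞(𝒯_∞([E, B])ᴴ (J - R))`
    (S₂ : Matrix (Fin n) (Fin c) ℂ) (hS₂ : IsRightNullMatrix (T₂ᴴ * (J - R)) S₂)
    -- `S₃ = 𝒮_∞([E; Bᴴ])`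
    (S₃ : Matrix (Fin n) (Fin d) ℂ) (hS₃ : IsRightNullMatrix (Matrix.fromRows E Bᴴ) S₃)
    -- `T₃ = 𝒯_∞((J - R) 𝒮_∞([E; Bᴴ]))`
    (T₃ : Matrix (Fin n) (Fin f) ℂ) (hT₃ : IsLeftNullMatrix ((J - R) * S₃) T₃) :
    ((∃ K F_S F_H : Matrix (Fin m) (Fin m) ℂ, IsRegularizingFeedback E J R B K F_S F_H) ↔
      ((Matrix.fromCols (Matrix.fromCols E (J - R)) B).rank = n ∧
        ((T₁ᴴ * E * S₂).rank : ℤ) = (Matrix.fromCols E B).rank - B.rank)) ∧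
    ((Matrix.fromCols (Matrix.fromCols E (J - R)) B).rank = n →
      ((T₁ᴴ * E * S₂).rank : ℤ) = (Matrix.fromCols E B).rank - B.rank →
      ∀ r : ℤ,
        (∃ K F_S F_H : Matrix (Fin m) (Fin m) ℂ,
          IsRegularizingFeedback E J R B K F_S F_H ∧ ((E + B * K * Bᴴ).rank : ℤ) = r) ↔
        (((Matrix.fromCols E B).rank : ℤ) - B.rank ≤ r ∧
          r ≤ ((T₃ᴴ * Matrix.fromCols E B).rank : ℤ))) := by
  have hcond := rank_conditions_iff (A := J - R) hT₁ hT₂ hS₂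
  obtain ⟨G, hG, hEG⟩ := exists_right_inverse_conjTranspose hE hB
  refine ⟨⟨?_, fun h => ?_⟩, fun h1 h2 r => ?_⟩
  · rintro ⟨K, F_S, F_H, h⟩
    exact hcond.2 (map_sup_range_eq_top_of_feedback h.kernelNondegenerate)
  -- For mere existence `N = ⊤` suffices: the inclusion required of `N` is then automatic.
  · obtain ⟨K, F_S, F_H, hK, -⟩ :=
      exists_isRegularizingFeedback hE hJ hR hG hEG (hcond.1 h) (N := ⊤) le_top
    exact ⟨K, F_S, F_H, hK⟩
  · have hT := rank_leftNull_mul_add hT₃ (fromCols E B)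
    rw [mulVecLin_mul, LinearMap.range_comp, range_eq_ker_of_isRightNullMatrix hS₃,
      ker_mulVecLin_fromRows] at hT
    constructor
    · rintro ⟨K, F_S, F_H, h, rfl⟩
      have hlow := rank_fromCols_le_of_feedback (E := E) (B := B) K
      have hupp := rank_feedback_add_le h.kernelNondegenerate
      omega
    · rintro ⟨hlow, hupp⟩
      -- The rank formula asks for `dim N = rank [E, B] - r`. The upper bound on `r` leaves room for
      -- the subspace `N` must contain and makes the truncation `toNat` harmless; the lower bound
      -- gives `dim N ≤ rank B = m`.
      obtain ⟨N, hN, hNr⟩ := exists_le_finrank_eq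
        ((LinearMap.range (fromCols E B).mulVecLin ⊓
          (LinearMap.ker E.mulVecLin ⊓ LinearMap.ker Bᴴ.mulVecLin).map (J - R).mulVecLin).map
            Gᴴ.mulVecLin) (k := ((fromCols E B).rank - r).toNat)
        ((Submodule.finrank_map_le _ _).trans (by omega))
        (by rw [Module.finrank_fin_fun]; omega)
      obtain ⟨K, F_S, F_H, hK, hr⟩ :=
        exists_isRegularizingFeedback hE hJ hR hG hEG (hcond.1 ⟨h1, h2⟩) hN
      refine ⟨K, F_S, F_H, hK, ?_⟩
      omega
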